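/- Let $\Gamma$ be a finite strongly connected directed graph (loops and multiple edges are allowed) in which every vertex has the same number $d \ge 1$ of outgoing edges, and let $k$ be a natural number. A coloring of $\Gamma$ assigns to every edge one of $d$ colors so that, at each vertex, the $d$ outgoing edges receive distinct colors; it turns $\Gamma$ into a complete deterministic automaton in which a word $s$ over the colors maps the set of all vertices onto a set $\Gamma s$. A word $s$ is $m$-synchronizing for the coloring if it is nonempty, $|\Gamma s| = m$, and $|\Gamma t| \ge m$ for all words $t$. A coloring is called $k$-synchronizing if it has a $k$-synchronizing word and $k$ is minimal over all colorings of $\Gamma$, that is, whenever some coloring of $\Gamma$ has an $m$-synchronizing word, $k \le m$. Then the greatest common divisor of the lengths of all cycles of $\Gamma$ is $k$ if and only if $\Gamma$ has a $k$-synchronizing coloring. Moreover, if this greatest common divisor is $k$, then every coloring of $\Gamma$ has an $m$-synchronizing word for some $m$, and every such $m$ satisfies $m \ge k$. -/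

import Mathlib

namespace RoadColoring

/-- A closed path is a cycle if it has positive length and visits no vertex twice. (The list
`p.toList` consists of the source vertices of the successive edges of `p`.) A loop is a cycle of
length one. -/
def IsCycle {V : Type*} [Quiver V] {a : V} (p : Quiver.Path a a) : Prop :=
  0 < p.length ∧ p.toList.Nodup

/-- The set of lengths of the cycles of a directed multigraph. -/
def cycleLengths (V : Type*) [Quiver V] : Set ℕ :=
  {n | ∃ (a : V) (p : Quiver.Path a a), IsCycle p ∧ p.length = n}

/-- `k` is the greatest common divisor of the lengths of all cycles. -/
def IsPeriodic (V : Type*) [Quiver V] (k : ℕ) : Prop :=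
  (∀ n ∈ cycleLengths V, k ∣ n) ∧ ∀ m : ℕ, (∀ n ∈ cycleLengths V, m ∣ n) → m ∣ k

/-- Every vertex has exactly `d` outgoing edges, counted with multiplicity. -/
def HasUniformOutdegree (V : Type*) [Quiver V] (d : ℕ) : Prop :=
  ∀ v : V, Finite (Quiver.Star v) ∧ Nat.card (Quiver.Star v) = d

/-- A coloring of a directed multigraph of uniform outdegree `d` by `d` colors turning it into a
(complete) deterministic automaton: at each vertex the outgoing edges are put in bijection with
the colors. -/
def Coloring (V : Type*) [Quiver V] (d : ℕ) : Type _ :=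
  (v : V) → Quiver.Star v ≃ Fin d

namespace Coloring

variable {V : Type*} [Quiver V] {d : ℕ}

/-- The end vertex of the unique edge of color `a` leaving `v`. -/
def step (c : Coloring V d) (v : V) (a : Fin d) : V :=
  ((c v).symm a).1

/-- The state `v s` reached from `v` by reading the word `s`. -/
def run (c : Coloring V d) (v : V) (s : List (Fin d)) : V :=
  s.foldl c.step v

/-- The image `Γ s` of the whole set of states under the word `s`. -/
def image (c : Coloring V d) (s : List (Fin d)) : Set V :=
  Set.range fun v => c.run v s

/-- `s` is a `k`-synchronizing word of the automaton given by the coloring `c`: `s` is nonempty,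
`|Γ s| = k`, and `|Γ t| ≥ k` for all words `t`. -/
def IsSynchronizingWord (c : Coloring V d) (k : ℕ) (s : List (Fin d)) : Prop :=
  s ≠ [] ∧ (c.image s).ncard = k ∧ ∀ t : List (Fin d), k ≤ (c.image t).ncard

/-- Under the coloring `c` the graph is a deterministic automaton with a `k`-synchronizing word. -/
def HasSynchronizingWord (c : Coloring V d) (k : ℕ) : Prop :=
  ∃ s : List (Fin d), c.IsSynchronizingWord k s

/-- `c` is a `k`-synchronizing coloring: the automaton has a `k`-synchronizing word, and `k` is
minimal, i.e. no coloring of the same graph yields a smaller value. -/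
def IsSynchronizing (c : Coloring V d) (k : ℕ) : Prop :=
  c.HasSynchronizingWord k ∧
    ∀ (c' : Coloring V d) (m : ℕ), c'.HasSynchronizingWord m → k ≤ m

end Coloring

end RoadColoring

namespace RoadColoring

/-! ### Functional graphs: cycles, trees, redirecting an edge -/

section FunctionalGraph

open Function

variable {V : Type*}

/-! Call a map to `ZMod n` that grows by one along every edge a potential. With `n > 0` it maps the
image of any word of any coloring onto `ZMod n`, so all ranks are at least `n`; also `n` divides all
cycle lengths. So it is enough to find such an `n` together with one coloring having a word of rank
at most `n` (`exists_recoloring_rank_le`): a common divisor `m` of the cycle lengths yields a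
potential modulo `lcm m n`, hence `lcm m n ≤ n` and `m ∣ n`. Thus `n` is both the gcd and the least
rank.

The coloring is found by Trahtman's method, by induction on the number of vertices. Stability of
pairs is a congruence; a recoloring of the quotient lifts, with rank no larger than that of a given
quotient word (`exists_word_of_quotient`), and potentials pull back. So a recoloring with a
nontrivial stable pair suffices, unless all edges leaving each vertex are parallel; then the graph
is one cycle and position on it is the potential.

One color is a functional graph: cycles with trees. If its highest trees hang at one vertex, an
image of minimal size contains at most one top vertex, and this produces a stable pair
(`exists_stable_of_hasUniqueMaximalTree`). Such a color comes from redirecting a few edges of a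
choice with as many cycle vertices as possible (`exists_hasUniqueMaximalTree`). The only obstruction
is two vertices with the same single successor, and these already form a stable pair. -/

theorem iterate_mem_periodicPts {f : V → V} {v : V} (h : v ∈ periodicPts f) (n : ℕ) :
    f^[n] v ∈ periodicPts f := by
  obtain ⟨m, hm, hp⟩ := h
  exact ⟨m, hm, hp.apply_iterate n⟩

theorem iterate_mem_periodicPts_of_le {f : V → V} {v : V} {m n : ℕ} (hmn : m ≤ n)
    (h : f^[m] v ∈ periodicPts f) : f^[n] v ∈ periodicPts f := by
  obtain ⟨k, rfl⟩ := Nat.exists_eq_add_of_le' hmn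
  rw [iterate_add_apply]
  exact iterate_mem_periodicPts h k

theorem exists_iterate_mem_periodicPts [Finite V] (f : V → V) (v : V) :
    ∃ n, f^[n] v ∈ periodicPts f := by
  obtain ⟨a, b, hab, h⟩ := Finite.exists_ne_map_eq_of_infinite fun n : ℕ => f^[n] v
  wlog hlt : a < b generalizing a b
  · exact this b a hab.symm h.symm (by omega)
  refine ⟨a, b - a, by omega, ?_⟩
  change f^[b - a] (f^[a] v) = f^[a] v
  rw [← iterate_add_apply, Nat.sub_add_cancel hlt.le]
  exact h.symm

theorem iterate_injOn_of_notMem_periodicPts {f : V → V} {v : V} {N a b : ℕ}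
    (h : f^[N] v ∉ periodicPts f) (ha : a ≤ N) (hb : b ≤ N) (hab : f^[a] v = f^[b] v) :
    a = b := by
  wlog hlt : a < b generalizing a b
  · by_contra hne
    exact hne (this hb ha hab.symm (by omega)).symm
  refine (h (iterate_mem_periodicPts_of_le ha ⟨b - a, by omega, ?_⟩)).elim
  change f^[b - a] (f^[a] v) = f^[a] v
  rw [← iterate_add_apply, Nat.sub_add_cancel hlt.le]
  exact hab.symm

theorem exists_iterate_eq_of_mem_periodicPts {f : V → V} {y q : V} (hy : y ∈ periodicPts f)
    {a : ℕ} (ha : f^[a] y = q) : ∃ b, f^[b] q = y := by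
  obtain ⟨n, hn, hp⟩ := hy
  -- `n * a` is a multiple of the period that is at least `a`.
  refine ⟨n * a - a, ?_⟩
  rw [← ha, ← iterate_add_apply, Nat.sub_add_cancel (Nat.le_mul_of_pos_left a hn)]
  exact hp.mul_const a

theorem first_iterate_or_forall_ne (f : V → V) (v q : V) :
    (∀ i, f^[i] v ≠ q) ∨ ∃ i, f^[i] v = q ∧ ∀ j < i, f^[j] v ≠ q := by
  classical
  by_cases h : ∃ i, f^[i] v = q
  · exact Or.inr ⟨Nat.find h, Nat.find_spec h, fun j hj => Nat.find_min h hj⟩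
  · exact Or.inl (not_exists.1 h)

/-- The depth at which an orbit becomes periodic is unique. -/
theorem eq_of_iterate_becomes_periodic {f : V → V} {v : V} {k l : ℕ}
    (hk : f^[k] v ∉ periodicPts f) (hk' : f^[k + 1] v ∈ periodicPts f)
    (hl : f^[l] v ∉ periodicPts f) (hl' : f^[l + 1] v ∈ periodicPts f) : k = l := by
  rcases lt_trichotomy k l with h | h | h
  · exact (hl (iterate_mem_periodicPts_of_le h hk')).elim
  · exact h
  · exact (hk (iterate_mem_periodicPts_of_le h hl')).elim

section Update

variable [DecidableEq V] {f : V → V} {q x v : V}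

theorem iterate_update {n : ℕ} (h : ∀ i < n, f^[i] v ≠ q) :
    (update f q x)^[n] v = f^[n] v := by
  induction n with
  | zero => rfl
  | succ n ih =>
    rw [iterate_succ_apply', iterate_succ_apply', ih fun i hi => h i (by omega),
      update_of_ne (h n (by omega))]

theorem iterate_update_add {i : ℕ} (hi : f^[i] v = q) (hlt : ∀ j < i, f^[j] v ≠ q) (k : ℕ) :
    (update f q x)^[i + 1 + k] v = (update f q x)^[k] x := by
  rw [add_comm, iterate_add_apply, iterate_succ_apply', iterate_update hlt, hi, update_self]

theorem mem_periodicPts_update_iff (h : ∀ i, f^[i] v ≠ q) :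
    v ∈ periodicPts (update f q x) ↔ v ∈ periodicPts f := by
  have key : ∀ n, (update f q x)^[n] v = f^[n] v := fun n => iterate_update fun i _ => h i
  simp only [mem_periodicPts, IsPeriodicPt, IsFixedPt, key]

theorem iterate_mem_periodicPts_update_iff (h : ∀ i, f^[i] v ≠ q) (n : ℕ) :
    (update f q x)^[n] v ∈ periodicPts (update f q x) ↔ f^[n] v ∈ periodicPts f := by
  rw [iterate_update fun i _ => h i]
  refine mem_periodicPts_update_iff fun i => ?_
  rw [← iterate_add_apply]
  exact h _

theorem notMem_periodicPts_update (h : ∀ i, f^[i] x ≠ q) :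
    q ∉ periodicPts (update f q x) := by
  rintro ⟨n, hn, hp⟩
  obtain ⟨m, rfl⟩ := Nat.exists_eq_add_of_lt hn
  have h1 : (update f q x)^[0 + m + 1] q = q := hp
  rw [iterate_succ_apply, update_self, iterate_update fun i _ => h i] at h1
  exact h _ h1

end Update

/-- All vertices of a functional graph that are at largest distance from the cycles, this
distance being positive, reach the cycles at the same vertex. (The bound `N` need not be the
largest one.) -/
def HasUniqueMaximalTree (f : V → V) : Prop :=
  ∃ (N : ℕ) (r : V), (∃ v, f^[N] v ∉ periodicPts f) ∧
    ∀ v n, N ≤ n → f^[n] v ∉ periodicPts f → f^[n + 1] v ∈ periodicPts f → f^[n + 1] v = r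

section Redirect

variable [DecidableEq V] {f : V → V} {q x : V}

/-- An orbit avoiding `q` is unchanged and is periodic by time `N`. Every higher vertex therefore
uses the new edge from `q` to `x` and enters the cycles where `x` did. -/
theorem hasUniqueMaximalTree_update_of_forall_ne [Finite V] (h : ∀ i, f^[i] x ≠ q)
    (hx : x ∉ periodicPts f) {N : ℕ} (hN : ∀ v, f^[N] v ∈ periodicPts f)
    (hv : ∃ v, (update f q x)^[N] v ∉ periodicPts (update f q x)) :
    HasUniqueMaximalTree (update f q x) := by
  classical
  obtain ⟨k, hk, hk'⟩ : ∃ k, f^[k] x ∉ periodicPts f ∧ f^[k + 1] x ∈ periodicPts f := by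
    have hex := exists_iterate_mem_periodicPts f x
    obtain ⟨m, hm⟩ : ∃ m, Nat.find hex = m + 1 := by
      refine Nat.exists_eq_succ_of_ne_zero fun h0 => hx ?_
      have := Nat.find_spec hex
      rwa [h0] at this
    exact ⟨m, Nat.find_min hex (by omega), hm ▸ Nat.find_spec hex⟩
  have hq := notMem_periodicPts_update (f := f) h
  refine ⟨N, f^[k + 1] x, hv, fun v n hn h1 h2 => ?_⟩
  rcases first_iterate_or_forall_ne f v q with hav | ⟨i, hi, hlt⟩
  · rw [iterate_mem_periodicPts_update_iff hav] at h1
    exact (h1 (iterate_mem_periodicPts_of_le hn (hN v))).elim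
  · rcases lt_trichotomy n i with hni | rfl | hni
    · refine (hq ?_).elim
      have := iterate_mem_periodicPts_of_le (show n + 1 ≤ i by omega) h2
      rwa [iterate_update hlt, hi] at this
    · have := iterate_update_add (x := x) hi hlt 0
      rw [add_zero] at this
      rw [this] at h2
      exact (hx ((mem_periodicPts_update_iff h).1 h2)).elim
    · obtain ⟨l, rfl⟩ := Nat.exists_eq_add_of_lt hni
      have e1 : i + l + 1 = i + 1 + l := by omega
      have e2 : i + l + 1 + 1 = i + 1 + (l + 1) := by omega
      rw [e1, iterate_update_add hi hlt, iterate_mem_periodicPts_update_iff h] at h1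
      rw [e2, iterate_update_add hi hlt, iterate_mem_periodicPts_update_iff h] at h2
      rw [e2, iterate_update_add hi hlt, iterate_update fun i _ => h i,
        eq_of_iterate_becomes_periodic hk hk' h1 h2]

theorem periodicPts_ssubset_update (hq : q ∉ periodicPts f) {j : ℕ} (hj : f^[j] x = q) :
    periodicPts f ⊂ periodicPts (update f q x) := by
  refine Set.ssubset_iff_subset_ne.2 ⟨fun v hv => ?_, fun he => hq (he ▸ ?_)⟩
  · refine (mem_periodicPts_update_iff fun i hi => hq ?_).2 hv
    exact hi ▸ iterate_mem_periodicPts hv i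
  · rcases first_iterate_or_forall_ne f x q with hav | ⟨i, hi, hlt⟩
    · exact (hav j hj).elim
    · refine ⟨i + 1, by omega, ?_⟩
      change (update f q x)^[i + 1] q = q
      rw [iterate_succ_apply, update_self, iterate_update hlt, hi]

/-- After the change `f q` has no preimage, and `x` is the only vertex with two. A tree meets a
cycle at a vertex with two preimages, hence at `x`. -/
theorem hasUniqueMaximalTree_update_of_bijective (hf : Bijective f) (hx : x ≠ f q) :
    HasUniqueMaximalTree (update f q x) := by
  refine ⟨0, x, ⟨f q, fun h => ?_⟩, fun v n _ h1 h2 => ?_⟩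
  · obtain ⟨y, hy⟩ := periodicPts_subset_range h
    by_cases hyq : y = q
    · rw [hyq, update_self] at hy
      exact hx hy
    · rw [update_of_ne hyq] at hy
      exact hyq (hf.1 hy)
  · rw [iterate_succ_apply'] at h2 ⊢
    generalize (update f q x)^[n] v = y at *
    by_cases hyq : y = q
    · rw [hyq, update_self]
    obtain ⟨m, hm, hp⟩ := h2
    obtain ⟨m, rfl⟩ := Nat.exists_eq_add_of_lt hm
    have h3 : (update f q x)^[0 + m + 1] (update f q x y) = update f q x y := hp
    rw [iterate_succ_apply'] at h3
    set z := (update f q x)^[0 + m] (update f q x y) with hz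
    by_cases hzq : z = q
    · rw [← h3, hzq, update_self]
    · rw [update_of_ne hzq, update_of_ne hyq] at h3
      have hzy := hf.1 h3
      refine (h1 ⟨0 + m + 1, by omega, ?_⟩).elim
      change (update f q x)^[0 + m + 1] y = y
      rw [iterate_succ_apply, ← hz, hzy]

end Redirect

end FunctionalGraph

/-! ### Redirecting an edge that leaves a cycle vertex -/

section FunctionalGraph

open Function

variable {V : Type*} [DecidableEq V] {f : V → V}

/-- Redirecting a cycle vertex `q` to a vertex `p` at largest distance `L + 1` from the cycles,
when `p` hangs on the cycle of `q`. -/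
theorem update_cycle_vertex [Finite V] {p q : V} {L : ℕ} (hq : q ∈ periodicPts f)
    (hp : f^[L] p ∉ periodicPts f) (hL : ∀ v, f^[L + 1] v ∈ periodicPts f)
    (hpq : ∃ i, f^[i] p = q)
    (hmax : (periodicPts (update f q p)).ncard ≤ (periodicPts f).ncard) :
    HasUniqueMaximalTree (update f q p) ∨
      (f^[L + 2] q = f^[L + 1] p ∧
        (periodicPts f).ncard ≤ (periodicPts (update f q p)).ncard ∧
        (∀ v, (update f q p)^[L + 1] v ∈ periodicPts (update f q p)) ∧
        (update f q p)^[L] (f q) ∉ periodicPts (update f q p) ∧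
        (update f q p)^[L] (f q) = f^[L + 1] q ∧
        (update f q p)^[L + 1] (f q) = f^[L + 1] p) := by
  set g := update f q p with hg
  set r := f^[L + 1] p with hr
  have hrP : r ∈ periodicPts f := hL p
  set h := minimalPeriod f r with hh
  have hpos : 0 < h := minimalPeriod_pos_of_mem_periodicPts hrP
  have htree : ∀ i ≤ L, f^[i] p ∉ periodicPts f := fun i hi hi' =>
    hp (iterate_mem_periodicPts_of_le hi hi')
  have hrit : ∀ k, f^[k] r = f^[L + 1 + k] p := fun k => by
    rw [hr, ← iterate_add_apply, add_comm]
  obtain ⟨j, hjh, hj⟩ : ∃ j < h, f^[j] r = q := by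
    obtain ⟨i, hi⟩ := hpq
    have hiL : L + 1 ≤ i := by
      by_contra hc
      exact htree i (by omega) (hi ▸ hq)
    obtain ⟨k, rfl⟩ := Nat.exists_eq_add_of_le hiL
    refine ⟨k % h, Nat.mod_lt _ hpos, ?_⟩
    rw [hh, iterate_mod_minimalPeriod_eq, hrit, hi]
  have hinj : ∀ {a b}, a < h → b < h → f^[a] r = f^[b] r → a = b := fun ha hb hab =>
    (iterate_eq_iterate_iff_of_lt_minimalPeriod ha hb).1 hab
  have hne : ∀ i < L + 1 + j, f^[i] p ≠ q := by
    intro i hi he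
    by_cases hiL : i ≤ L
    · exact htree i hiL (he ▸ hq)
    · obtain ⟨k, rfl⟩ := Nat.exists_eq_add_of_le (show L + 1 ≤ i by omega)
      rw [← hrit, ← hj] at he
      have := hinj (by omega) hjh he
      omega
  have hgp : ∀ k ≤ L + 1 + j, g^[k] p = f^[k] p := fun k hk =>
    iterate_update fun i hi => hne i (by omega)
  have hgq : g^[L + 1 + j] p = q := by rw [hgp _ le_rfl, ← hrit, hj]
  have hper : IsPeriodicPt g (L + 1 + j + 1) p := by
    change g^[L + 1 + j + 1] p = p
    rw [iterate_succ_apply', hgq, hg, update_self]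
  have hpg : p ∈ periodicPts g := ⟨_, by omega, hper⟩
  have hqg : q ∈ periodicPts g := hgq ▸ iterate_mem_periodicPts hpg _
  have hgp' : ∀ k ≤ L + 1 + j, f^[k] p ∈ periodicPts g := fun k hk =>
    hgp k hk ▸ iterate_mem_periodicPts hpg _
  -- the part of the old cycle that is kept is covered by the new cycle
  have hkeep : ∀ y ∈ periodicPts f, y ∉ periodicPts g → ∃ i, j < i ∧ i < h ∧ f^[i] r = y := by
    intro y hy hyg
    rcases first_iterate_or_forall_ne f y q with hav | ⟨i, hi, -⟩
    · exact (hyg ((mem_periodicPts_update_iff hav).2 hy)).elim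
    · obtain ⟨b, hb⟩ := exists_iterate_eq_of_mem_periodicPts hy hi
      have hb' : f^[(b + j) % h] r = y := by
        rw [hh, iterate_mod_minimalPeriod_eq, iterate_add_apply, hj, hb]
      refine ⟨(b + j) % h, ?_, Nat.mod_lt _ hpos, hb'⟩
      by_contra hc
      refine hyg ?_
      rw [← hb', hrit]
      exact hgp' _ (by omega)
  have hlost : ∀ i, j < i → i < h → f^[i] r ∉ periodicPts g := by
    intro i hji hih hy
    have hyP : f^[i] r ∈ periodicPts f := iterate_mem_periodicPts hrP i
    rcases first_iterate_or_forall_ne f (f^[i] r) q with hav | ⟨a, ha, hlt⟩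
    · obtain ⟨b, hb⟩ := exists_iterate_eq_of_mem_periodicPts (iterate_mem_periodicPts hrP j)
        (show f^[i - j] (f^[j] r) = f^[i] r by
          rw [← iterate_add_apply, Nat.sub_add_cancel hji.le])
      exact hav b (hb.trans hj)
    · have ha' : g^[a] (f^[i] r) = q := by rw [hg, iterate_update hlt, ha]
      obtain ⟨b, hb⟩ := exists_iterate_eq_of_mem_periodicPts hy ha'
      rw [← hgq, ← iterate_add_apply, ← hper.iterate_mod_apply] at hb
      have hlt' := Nat.mod_lt (b + (L + 1 + j)) (show 0 < L + 1 + j + 1 by omega)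
      set b' := (b + (L + 1 + j)) % (L + 1 + j + 1)
      rw [hgp _ (by omega)] at hb
      by_cases hbL : b' ≤ L
      · exact htree b' hbL (hb ▸ hyP)
      · obtain ⟨k, hk⟩ := Nat.exists_eq_add_of_le (show L + 1 ≤ b' by omega)
        rw [hk, ← hrit] at hb
        have := hinj (by omega) hih hb
        omega
  -- The new cycle runs from `p` through `r` to `q = f^[j] r` and back to `p`. It gains the `L + 1`
  -- tree vertices before `r` and drops the arc of `h - (j + 1)` vertices between `q` and `r`; by
  -- `hmax` this arc has at least `L + 1` vertices.
  have hcard : (periodicPts f).ncard + (L + 1) ≤ (periodicPts g).ncard + (h - (j + 1)) := by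
    set D : Set V := (fun i => f^[i] r) '' ((Finset.Ico (j + 1) h : Finset ℕ) : Set ℕ)
    set G : Set V := (fun i => f^[i] p) '' ((Finset.range (L + 1) : Finset ℕ) : Set ℕ)
    have hD : D.ncard ≤ h - (j + 1) := by
      refine (Set.ncard_image_le (Finset.finite_toSet _)).trans ?_
      rw [Set.ncard_coe_finset, Nat.card_Ico]
    have hG : G.ncard = L + 1 := by
      have hinjG : Set.InjOn (fun i => f^[i] p) ((Finset.range (L + 1) : Finset ℕ) : Set ℕ) := by
        intro a ha b hb hab
        simp only [Finset.coe_range, Set.mem_Iio] at ha hb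
        exact iterate_injOn_of_notMem_periodicPts hp (by omega) (by omega) hab
      rw [hinjG.ncard_image, Set.ncard_coe_finset, Finset.card_range]
    have hGsub : G ⊆ periodicPts g := by
      rintro _ ⟨i, hi, rfl⟩
      simp only [Finset.coe_range, Set.mem_Iio] at hi
      exact hgp' i (by omega)
    have hdisj : Disjoint (periodicPts f) G := by
      rw [Set.disjoint_right]
      rintro _ ⟨i, hi, rfl⟩
      simp only [Finset.coe_range, Set.mem_Iio] at hi
      exact htree i (by omega)
    have hsub : periodicPts f ∪ G ⊆ periodicPts g ∪ D := by
      rintro y (hy | hy)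
      · by_cases hyg : y ∈ periodicPts g
        · exact Or.inl hyg
        · obtain ⟨i, h1, h2, h3⟩ := hkeep y hy hyg
          exact Or.inr ⟨i, by simp; omega, h3⟩
      · exact Or.inl (hGsub hy)
    calc (periodicPts f).ncard + (L + 1) = (periodicPts f ∪ G).ncard := by
          rw [Set.ncard_union_eq hdisj (Set.toFinite _) (Set.toFinite _), hG]
      _ ≤ (periodicPts g ∪ D).ncard := Set.ncard_le_ncard hsub (Set.toFinite _)
      _ ≤ (periodicPts g).ncard + D.ncard := Set.ncard_union_le _ _
      _ ≤ _ := by omega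
  have hs : ∀ k, f^[k] (f q) = f^[k + 1 + j] r := fun k => by
    rw [← hj, ← iterate_succ_apply, ← iterate_add_apply]
  have hsg : ∀ k, k + 1 + j < h + 1 → g^[k] (f q) = f^[k] (f q) := fun k hk => by
    refine iterate_update fun i hi he => ?_
    rw [hs, ← hj] at he
    have := hinj (by omega) hjh he
    omega
  -- After `L + 1` steps a vertex was on an old cycle, so if it is still not periodic it lies on the
  -- dropped arc, which ends at `r`.
  have hroot : ∀ v n, L + 1 ≤ n → g^[n] v ∉ periodicPts g → g^[n + 1] v ∈ periodicPts g →
      g^[n + 1] v = r := by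
    intro v n hn h1 h2
    rcases first_iterate_or_forall_ne f v q with hav | ⟨i, hi, hlt⟩
    · rw [hg, iterate_mem_periodicPts_update_iff hav] at h1
      exact (h1 (iterate_mem_periodicPts_of_le hn (hL v))).elim
    · have hni : n < i := by
        by_contra hc
        refine h1 (iterate_mem_periodicPts_of_le (show i ≤ n by omega) ?_)
        rwa [hg, iterate_update hlt, hi]
      rw [hg, iterate_update fun k hk => hlt k (by omega)] at h1 h2 ⊢
      obtain ⟨a, ha1, ha2, ha3⟩ := hkeep _ (iterate_mem_periodicPts_of_le hn (hL v)) h1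
      rw [iterate_succ_apply', ← ha3, ← iterate_succ_apply' f] at h2 ⊢
      have : a + 1 = h := by
        by_contra hc
        exact hlost (a + 1) (by omega) (by omega) h2
      rw [Nat.succ_eq_add_one, this, hh, iterate_minimalPeriod]
  by_cases hex : ∃ v, g^[L + 1] v ∉ periodicPts g
  · exact Or.inl ⟨L + 1, r, hex, hroot⟩
  push Not at hex
  -- The dropped arc is now a tree path starting at `f q`. No height exceeds `L + 1`, so together
  -- with `hmax` the arc has exactly `L + 1` vertices.
  have hle : h ≤ L + 2 + j := by
    by_contra hc
    have := hex (f q)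
    rw [hsg _ (by omega), hs] at this
    exact hlost _ (by omega) (by omega) this
  have heq : L + 1 + 1 + j = h := by omega
  have hq2 : f^[L + 2] q = r := by
    rw [iterate_succ_apply, hs, heq, hh, iterate_minimalPeriod]
  refine Or.inr ⟨hq2, by omega, hex, ?_, ?_, ?_⟩
  · rw [hsg _ (by omega), hs]
    exact hlost _ (by omega) (by omega)
  · rw [hsg _ (by omega), ← iterate_succ_apply]
  · rw [hsg _ (by omega), ← iterate_succ_apply, hq2]

end FunctionalGraph

/-! ### Choices of edges with as many cycle vertices as possible -/

/-- A choice of one outgoing edge at every vertex that has the largest possible number of vertices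
on cycles. -/
structure IsMaximalChoice {V : Type*} (E : V → V → Prop) (f : V → V) : Prop where
  edge : ∀ v, E v (f v)
  max : ∀ g : V → V, (∀ v, E v (g v)) →
    (Function.periodicPts g).ncard ≤ (Function.periodicPts f).ncard

section Choice

open Function

variable {V : Type*} {E : V → V → Prop} {f : V → V} {L : ℕ} {p q : V}

theorem edge_update [DecidableEq V] (hf : ∀ v, E v (f v)) (hqp : E q p) (v : V) :
    E v (update f q p v) := by
  by_cases h : v = q
  · subst h
    rwa [update_self]
  · rw [update_of_ne h]
    exact hf v

/-- Otherwise redirecting `q` to `p` would close a new cycle through `q` and keep all old ones. -/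
theorem IsMaximalChoice.iterate_ne [Finite V] (hf : IsMaximalChoice E f)
    (hq : q ∉ periodicPts f) (hqp : E q p) (i : ℕ) : f^[i] p ≠ q := by
  classical
  intro h
  have := Set.ncard_lt_ncard (periodicPts_ssubset_update hq h) (Set.toFinite _)
  exact absurd (hf.max _ (edge_update hf.edge hqp)) (by omega)

/-- An edge entering a vertex `p` at largest distance from the cycles. -/
theorem IsMaximalChoice.in_edge [Finite V] (hf : IsMaximalChoice E f)
    (hp : f^[L] p ∉ periodicPts f) (hL : ∀ v, f^[L + 1] v ∈ periodicPts f) (hqp : E q p) :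
    (∃ g : V → V, (∀ v, E v (g v)) ∧ HasUniqueMaximalTree g) ∨
      (q ∈ periodicPts f ∧ f^[L + 2] q = f^[L + 1] p ∧ ∃ (g : V → V) (s : V),
        IsMaximalChoice E g ∧ (∀ v, g^[L + 1] v ∈ periodicPts g) ∧ g^[L] s ∉ periodicPts g ∧
        g^[L] s = f^[L + 1] q ∧ g^[L + 1] s = f^[L + 1] p) := by
  classical
  have hg := edge_update hf.edge hqp
  have hpP : p ∉ periodicPts f := fun h => hp (iterate_mem_periodicPts h L)
  by_cases hav : ∀ i, f^[i] p ≠ q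
  · refine Or.inl ⟨_, hg, hasUniqueMaximalTree_update_of_forall_ne hav hpP hL ⟨q, ?_⟩⟩
    rw [iterate_succ_apply, update_self, iterate_mem_periodicPts_update_iff hav]
    exact hp
  push Not at hav
  have hq : q ∈ periodicPts f := by
    by_contra hq
    obtain ⟨i, hi⟩ := hav
    exact hf.iterate_ne hq hqp i hi
  rcases update_cycle_vertex hq hp hL hav (hf.max _ hg) with h | ⟨h1, h2, h3, h4, h5, h6⟩
  · exact Or.inl ⟨_, hg, h⟩
  · exact Or.inr ⟨hq, h1, _, f q, ⟨hg, fun g' hg' => (hf.max g' hg').trans h2⟩, h3, h4, h5, h6⟩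

/-- Redirecting the last tree vertex below a vertex at largest distance from the cycles. -/
theorem IsMaximalChoice.exists_of_redirect [Finite V] (hf : IsMaximalChoice E f)
    (hp : f^[L] p ∉ periodicPts f) (hL : ∀ v, f^[L + 1] v ∈ periodicPts f) (hqp : E q p)
    {t : V} (ht : E (f^[L] p) t) (htr : t ≠ f^[L + 1] p) :
    ∃ g : V → V, (∀ v, E v (g v)) ∧ HasUniqueMaximalTree g := by
  classical
  set c := f^[L] p with hc
  have hav : ∀ i, f^[i] t ≠ c := hf.iterate_ne hp ht
  have hg := edge_update hf.edge ht
  set g := update f c t with hgdef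
  have hpc : ∀ j < L, f^[j] p ≠ c := fun j hj he => by
    have := iterate_injOn_of_notMem_periodicPts (by rwa [← hc]) hj.le le_rfl he
    omega
  have hgpL : g^[L] p = c := by rw [hgdef, iterate_update hpc]
  have hgp : g^[L + 1] p = t := by rw [iterate_succ_apply', hgpL, hgdef, update_self]
  have hPc : ∀ v ∈ periodicPts f, ∀ i, f^[i] v ≠ c := fun v hv i hi =>
    hp (hi ▸ iterate_mem_periodicPts hv i)
  by_cases htP : t ∈ periodicPts f
  · have hcg : c ∉ periodicPts g := notMem_periodicPts_update hav
    have hsub : periodicPts f ⊆ periodicPts g := fun v hv =>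
      (mem_periodicPts_update_iff (hPc v hv)).2 hv
    have hmaxg : IsMaximalChoice E g := ⟨hg, fun g' hg' =>
      (hf.max g' hg').trans (Set.ncard_le_ncard hsub (Set.toFinite _))⟩
    have hLg : ∀ v, g^[L + 1] v ∈ periodicPts g := by
      intro v
      rcases first_iterate_or_forall_ne f v c with h | ⟨i, hi, hlt⟩
      · exact (iterate_mem_periodicPts_update_iff h _).2 (hL v)
      · have hiL : i ≤ L := by
          by_contra hcon
          exact hp (hi ▸ iterate_mem_periodicPts_of_le (by omega) (hL v))
        refine iterate_mem_periodicPts_of_le (show i + 1 ≤ L + 1 by omega) ?_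
        have := iterate_update_add (x := t) hi hlt 0
        rw [add_zero] at this
        rw [hgdef, this]
        exact hsub htP
    -- `f` and `g` are both maximal with `p` at the top, so the same `q` returns after `L + 2` steps
    -- to `f^[L + 1] p` under `f` and to `t` under `g`. They agree along the old cycles, which
    -- forces `t = f^[L + 1] p`.
    rcases hf.in_edge hp hL hqp with h | ⟨hq, h1, -⟩
    · exact h
    rcases hmaxg.in_edge (by rwa [hgpL]) hLg hqp with h | ⟨-, h2, -⟩
    · exact h
    rw [hgp, hgdef, iterate_update fun i _ => hPc q hq i, h1] at h2
    exact (htr h2.symm).elim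
  · refine ⟨g, hg, hasUniqueMaximalTree_update_of_forall_ne hav htP hL ⟨p, ?_⟩⟩
    rw [← hgdef, hgp, mem_periodicPts_update_iff hav]
    exact htP

/-- A strongly connected graph in which some vertex has two successors, and no two vertices have
the same vertex as their only successor, has a choice of one outgoing edge at every vertex for
which the highest trees hang at one vertex. -/
theorem exists_hasUniqueMaximalTree [Finite V] (hE : ∀ v, ∃ w, E v w)
    (hconn : ∀ v w, Relation.ReflTransGen E v w)
    (hbunch : ∀ u v r, (∀ x, E u x → x = r) → (∀ x, E v x → x = r) → u = v)
    (hbranch : ∃ v x y, E v x ∧ E v y ∧ x ≠ y) :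
    ∃ g : V → V, (∀ v, E v (g v)) ∧ HasUniqueMaximalTree g := by
  classical
  obtain ⟨f, hf⟩ : ∃ f : V → V, IsMaximalChoice E f := by
    choose f₀ hf₀ using hE
    obtain ⟨f, hf, hmax⟩ := Set.exists_max_image {f : V → V | ∀ v, E v (f v)}
      (fun f => (periodicPts f).ncard) (Set.toFinite _) ⟨f₀, hf₀⟩
    exact ⟨f, hf, hmax⟩
  by_cases hall : ∀ v, v ∈ periodicPts f
  · obtain ⟨q, x, hqx, hx⟩ : ∃ q x, E q x ∧ x ≠ f q := by
      obtain ⟨v, x, y, hx, hy, hxy⟩ := hbranch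
      by_cases h : x = f v
      · exact ⟨v, y, hy, fun h' => hxy (h.trans h'.symm)⟩
      · exact ⟨v, x, hx, h⟩
    refine ⟨_, edge_update hf.edge hqx, hasUniqueMaximalTree_update_of_bijective ?_ hx⟩
    exact Finite.surjective_iff_bijective.1 fun v => periodicPts_subset_range (hall v)
  obtain ⟨L, hL, p, hp⟩ : ∃ L, (∀ v, f^[L + 1] v ∈ periodicPts f) ∧
      ∃ p, f^[L] p ∉ periodicPts f := by
    have hex : ∃ N, ∀ v, f^[N] v ∈ periodicPts f := by
      choose n hn using exists_iterate_mem_periodicPts f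
      obtain ⟨N, hN⟩ := (Set.finite_range n).bddAbove
      exact ⟨N, fun v => iterate_mem_periodicPts_of_le (hN ⟨v, rfl⟩) (hn v)⟩
    obtain ⟨L, hL⟩ : ∃ L, Nat.find hex = L + 1 := by
      refine Nat.exists_eq_succ_of_ne_zero fun h0 => hall ?_
      have := Nat.find_spec hex
      rwa [h0] at this
    refine ⟨L, hL ▸ Nat.find_spec hex, ?_⟩
    have := Nat.find_min hex (m := L) (by omega)
    push Not at this
    exact this
  have hin : ∀ p : V, (∃ r, r ≠ p) → ∃ q, E q p := by
    rintro p ⟨r, hr⟩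
    rcases Relation.ReflTransGen.cases_tail (hconn r p) with h | ⟨q, -, hq⟩
    · exact (hr h.symm).elim
    · exact ⟨q, hq⟩
  have hin' : ∀ {f : V → V} {p : V}, f^[L] p ∉ periodicPts f → f^[L + 1] p ∈ periodicPts f →
      ∃ q, E q p := fun {f p} h1 h2 => hin p ⟨f^[L + 1] p, fun he =>
    h1 (iterate_mem_periodicPts (he ▸ h2) L)⟩
  obtain ⟨q, hqp⟩ := hin' hp (hL p)
  rcases hf.in_edge hp hL hqp with h | ⟨hq, h1, g, s, hg, hLg, hs, hs1, hs2⟩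
  · exact h
  obtain ⟨q', hqs⟩ := hin' hs (hLg s)
  by_cases hc : ∃ t, E (f^[L] p) t ∧ t ≠ f^[L + 1] p
  · obtain ⟨t, ht, htr⟩ := hc
    exact hf.exists_of_redirect hp hL hqp ht htr
  by_cases hc' : ∃ t, E (g^[L] s) t ∧ t ≠ g^[L + 1] s
  · obtain ⟨t, ht, htr⟩ := hc'
    exact hg.exists_of_redirect hs hLg hqs ht htr
  push Not at hc hc'
  rw [hs2] at hc'
  -- `f^[L] p` and `f^[L + 1] q` now have the same only successor, so they coincide; but the first
  -- is off the cycles of `f` and the second is on one.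
  refine (hp ?_).elim
  rw [hbunch _ _ _ hc hc', hs1]
  exact iterate_mem_periodicPts hq _

end Choice

/-! ### Stable pairs and words of minimal rank -/

section Automaton

open Function

variable {V A : Type*}

theorem foldl_replicate_eq_iterate (δ : V → A → V) (a : A) (n : ℕ) (v : V) :
    (List.replicate n a).foldl δ v = (fun x => δ x a)^[n] v := by
  induction n generalizing v with
  | zero => rfl
  | succ n ih => rw [List.replicate_succ, List.foldl_cons, ih, iterate_succ_apply]

/-- Two states are stable if every word can be prolonged to one that merges them. -/
def Stable (δ : V → A → V) (p q : V) : Prop :=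
  ∀ u : List A, ∃ w : List A, (u ++ w).foldl δ p = (u ++ w).foldl δ q

/-- The image of the set of all states under the word `w`. -/
def imageOf (δ : V → A → V) (w : List A) : Set V :=
  Set.range fun v => w.foldl δ v

/-- The word `w` has the smallest possible rank. -/
def IsMinimalWord (δ : V → A → V) (w : List A) : Prop :=
  ∀ t : List A, (imageOf δ w).ncard ≤ (imageOf δ t).ncard

variable {δ : V → A → V}

theorem Stable.refl (p : V) : Stable δ p p := fun _ => ⟨[], rfl⟩

theorem Stable.symm {p q : V} (h : Stable δ p q) : Stable δ q p := fun u =>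
  (h u).imp fun _ hw => hw.symm

theorem Stable.trans {p q r : V} (h : Stable δ p q) (h' : Stable δ q r) : Stable δ p r := by
  intro u
  obtain ⟨w, hw⟩ := h u
  obtain ⟨w', hw'⟩ := h' (u ++ w)
  refine ⟨w ++ w', ?_⟩
  rw [← List.append_assoc, ← hw', List.foldl_append, hw, ← List.foldl_append]

theorem Stable.step {p q : V} (h : Stable δ p q) (a : A) : Stable δ (δ p a) (δ q a) :=
  fun u => h (a :: u)

theorem Stable.foldl {p q : V} (h : Stable δ p q) (w : List A) :
    Stable δ (w.foldl δ p) (w.foldl δ q) := by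
  intro u
  obtain ⟨t, ht⟩ := h (w ++ u)
  refine ⟨t, ?_⟩
  rwa [← List.foldl_append, ← List.foldl_append, ← List.append_assoc]

/-- The congruence given by the stable pairs. -/
def stableSetoid (δ : V → A → V) : Setoid V :=
  ⟨Stable δ, Stable.refl, Stable.symm, Stable.trans⟩

theorem imageOf_append (u w : List A) :
    imageOf δ (u ++ w) = (fun v => w.foldl δ v) '' imageOf δ u := by
  rw [imageOf, imageOf, ← Set.range_comp]
  congr 1
  funext v
  simp

theorem imageOf_append_subset (u w : List A) : imageOf δ (u ++ w) ⊆ imageOf δ w := by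
  rw [imageOf_append]
  exact Set.image_subset_range _ _

theorem exists_isMinimalWord (δ : V → A → V) : ∃ w, IsMinimalWord δ w := by
  classical
  have hex : ∃ n, ∃ w, (imageOf δ w).ncard = n := ⟨_, [], rfl⟩
  obtain ⟨w, hw⟩ := Nat.find_spec hex
  exact ⟨w, fun t => hw ▸ Nat.find_min' hex ⟨t, rfl⟩⟩

theorem exists_foldl_eq (hconn : ∀ v w, Relation.ReflTransGen (fun x y => ∃ a, δ x a = y) v w)
    (v w : V) : ∃ u : List A, u.foldl δ v = w := by
  induction hconn v w with
  | refl => exact ⟨[], rfl⟩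
  | tail _ h ih =>
    obtain ⟨u, rfl⟩ := ih
    obtain ⟨a, rfl⟩ := h
    exact ⟨u ++ [a], by simp⟩

section Finite

variable [Finite V]

theorem IsMinimalWord.append {w : List A} (hw : IsMinimalWord δ w) (u : List A) :
    IsMinimalWord δ (w ++ u) := fun t => by
  refine le_trans ?_ (hw t)
  rw [imageOf_append]
  exact Set.ncard_image_le

theorem IsMinimalWord.injOn {w : List A} (hw : IsMinimalWord δ w) (u : List A) :
    Set.InjOn (fun v => u.foldl δ v) (imageOf δ w) := by
  refine Set.injOn_of_ncard_image_eq ?_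
  refine le_antisymm Set.ncard_image_le ?_
  rw [← imageOf_append]
  exact hw _

/-- Two images of smallest size that differ in one element each give a stable pair. -/
theorem stable_of_imageOf_eq_insert {w w' : List A} (hw : IsMinimalWord δ w)
    (hw' : IsMinimalWord δ w') {C : Set V} {p q : V} (hpC : p ∉ C) (hqC : q ∉ C)
    (hp : imageOf δ w = insert p C) (hq : imageOf δ w' = insert q C) : Stable δ p q := by
  intro u
  by_contra hcon
  push Not at hcon
  have hpq : p ≠ q := fun h => hcon [] (by rw [h])
  -- Minimality gives injectivity on each of the two images, and `hcon` separates `p` from `q`. The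
  -- image then has `|C| + 2` elements inside a set of `|C| + 1`.
  have hinj : Set.InjOn (fun v => (u ++ w).foldl δ v) (insert p (insert q C)) := by
    have h1 := hw.injOn (u ++ w)
    have h2 := hw'.injOn (u ++ w)
    rw [hp] at h1
    rw [hq] at h2
    refine (Set.injOn_insert (by simp [hpq, hpC])).2 ⟨h2, ?_⟩
    rintro ⟨x, rfl | hx, hxp⟩
    · exact hcon w hxp.symm
    · exact hpC (h1 (Set.mem_insert_of_mem _ hx) (Set.mem_insert _ _) hxp ▸ hx)
  have hle : ((fun v => (u ++ w).foldl δ v) '' insert p (insert q C)).ncard ≤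
      (imageOf δ w).ncard := by
    refine Set.ncard_le_ncard ?_ (Set.toFinite _)
    exact (Set.image_subset_range _ _).trans (imageOf_append_subset u w)
  rw [hinj.ncard_image, hp, Set.ncard_insert_of_notMem (by simp [hpq, hpC]),
    Set.ncard_insert_of_notMem hpC, Set.ncard_insert_of_notMem hqC] at hle
  omega

theorem exists_pos_forall_iterate_eq (f : V → V) :
    ∃ K, 0 < K ∧ ∀ x ∈ periodicPts f, f^[K] x = x := by
  classical
  have := Fintype.ofFinite V
  refine ⟨∏ x ∈ Finset.univ.filter (· ∈ periodicPts f), minimalPeriod f x,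
    Finset.prod_pos fun x hx => ?_, fun x hx => ?_⟩
  · exact minimalPeriod_pos_of_mem_periodicPts (Finset.mem_filter.1 hx).2
  · exact isPeriodicPt_iff_minimalPeriod_dvd.2 (Finset.dvd_prod_of_mem _ (by simpa using hx))

theorem HasUniqueMaximalTree.exists_height {f : V → V} (h : HasUniqueMaximalTree f) :
    ∃ (L : ℕ) (p r : V), f^[L] p ∉ periodicPts f ∧ (∀ v, f^[L + 1] v ∈ periodicPts f) ∧
      ∀ v, f^[L] v ∉ periodicPts f → f^[L + 1] v = r := by
  classical
  obtain ⟨N, r, ⟨v₀, hv₀⟩, hr⟩ := h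
  have hex : ∃ n, ∀ v, f^[N + n + 1] v ∈ periodicPts f := by
    choose n hn using exists_iterate_mem_periodicPts f
    obtain ⟨M, hM⟩ := (Set.finite_range n).bddAbove
    exact ⟨M, fun v => iterate_mem_periodicPts_of_le
      ((hM ⟨v, rfl⟩).trans (by omega)) (hn v)⟩
  obtain ⟨p, hp⟩ : ∃ p, f^[N + Nat.find hex] p ∉ periodicPts f := by
    rcases Nat.eq_zero_or_eq_succ_pred (Nat.find hex) with h0 | hs
    · exact ⟨v₀, by rwa [h0]⟩
    · have := Nat.find_min hex (m := (Nat.find hex).pred) (by omega)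
      push Not at this
      rwa [add_assoc, ← Nat.succ_eq_add_one, ← hs] at this
  exact ⟨_, p, r, hp, Nat.find_spec hex, fun v hv => hr v _ (by omega) hv (Nat.find_spec hex v)⟩

/-- Move a minimal image so that it contains a top vertex `p`. Any other top vertex in it would
merge with `p` at the common root, so after `a ^ L` only `s = f^[L] p` is off the cycles. Applying
`a ^ K`, with `K` a common period, fixes the rest and changes `s`, so two minimal images differ in
one state each. -/
theorem exists_stable_of_hasUniqueMaximalTree
    (hconn : ∀ v w, Relation.ReflTransGen (fun x y => ∃ a, δ x a = y) v w) {a : A}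
    (h : HasUniqueMaximalTree fun v => δ v a) : ∃ p q, p ≠ q ∧ Stable δ p q := by
  set f : V → V := fun v => δ v a with hf
  have hword : ∀ n v, (List.replicate n a).foldl δ v = f^[n] v := fun n v =>
    foldl_replicate_eq_iterate δ a n v
  obtain ⟨L, p, r, hp, hL, hr⟩ := h.exists_height
  obtain ⟨w₀, hw₀⟩ := exists_isMinimalWord δ
  obtain ⟨u, hu⟩ := exists_foldl_eq hconn (w₀.foldl δ p) p
  have hw₁ := hw₀.append u
  set w₁ := w₀ ++ u with hw₁_def
  have hpw₁ : p ∈ imageOf δ w₁ := ⟨p, by simp [hw₁_def, hu]⟩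
  have hother : ∀ x ∈ imageOf δ w₁, f^[L] x ∉ periodicPts f → x = p := by
    intro x hx hxL
    refine hw₁.injOn (List.replicate (L + 1) a) hx hpw₁ ?_
    simp only [hword]
    rw [hr x hxL, hr p hp]
  have hw₂ := hw₁.append (List.replicate L a)
  set w₂ := w₁ ++ List.replicate L a with hw₂_def
  have himg₂ : imageOf δ w₂ = f^[L] '' imageOf δ w₁ := by
    rw [hw₂_def, imageOf_append]
    simp only [hword]
  set s := f^[L] p with hs
  set C := imageOf δ w₂ \ {s} with hC
  have hsw₂ : s ∈ imageOf δ w₂ := himg₂ ▸ ⟨p, hpw₁, rfl⟩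
  have hCP : ∀ x ∈ C, x ∈ periodicPts f := by
    rintro x ⟨hx, hxs⟩
    rw [himg₂] at hx
    obtain ⟨y, hy, rfl⟩ := hx
    by_contra hcon
    exact hxs (by rw [hother y hy hcon]; rfl)
  have hins₂ : imageOf δ w₂ = insert s C := by
    rw [hC, Set.insert_sdiff_singleton, Set.insert_eq_of_mem hsw₂]
  obtain ⟨K, hK, hKper⟩ := exists_pos_forall_iterate_eq f
  have hw₃ := hw₂.append (List.replicate K a)
  have hins₃ : imageOf δ (w₂ ++ List.replicate K a) = insert (f^[K] s) C := by
    rw [imageOf_append, hins₂, Set.image_insert_eq]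
    simp only [hword]
    congr 1
    calc _ = (fun x => x) '' C := Set.image_congr fun x hx => hKper x (hCP x hx)
      _ = C := Set.image_id' C
  have hsK : f^[K] s ∈ periodicPts f := by
    rw [hs, ← iterate_add_apply]
    exact iterate_mem_periodicPts_of_le (by omega) (hL p)
  have hsC : s ∉ C := fun h => h.2 rfl
  refine ⟨s, f^[K] s, fun he => hp (he ▸ hsK), stable_of_imageOf_eq_insert hw₂ hw₃ hsC ?_
    hins₂ hins₃⟩
  intro hcon
  have := hw₂.injOn (List.replicate K a) hsw₂ hcon.1 (by
    simp only [hword]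
    exact (hKper _ (hCP _ hcon)).symm)
  exact hcon.2 this.symm

/-- A strongly connected automaton can be recolored to have a nontrivial stable pair, unless its
graph is a cycle with multiple edges. -/
theorem exists_recoloring_stable [Nonempty A]
    (hconn : ∀ v w, Relation.ReflTransGen (fun x y => ∃ a, δ x a = y) v w) :
    (∃ π : V → Equiv.Perm A, ∃ p q, p ≠ q ∧ Stable (fun v a => δ v (π v a)) p q) ∨
      ∀ v a b, δ v a = δ v b := by
  classical
  by_cases hbunch : ∀ u v r, (∀ x, (∃ a, δ u a = x) → x = r) → (∀ x, (∃ a, δ v a = x) → x = r) →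
      u = v
  swap
  · push Not at hbunch
    obtain ⟨u, v, r, hu, hv, huv⟩ := hbunch
    refine Or.inl ⟨fun _ => 1, u, v, huv, fun t => ?_⟩
    obtain ⟨a⟩ := ‹Nonempty A›
    cases t with
    | nil => exact ⟨[a], by simp [hu _ ⟨a, rfl⟩, hv _ ⟨a, rfl⟩]⟩
    | cons b t => exact ⟨[], by simp [hu _ ⟨b, rfl⟩, hv _ ⟨b, rfl⟩]⟩
  by_cases hbranch : ∃ v x y, (∃ a, δ v a = x) ∧ (∃ a, δ v a = y) ∧ x ≠ y
  · left
    obtain ⟨a₀⟩ := ‹Nonempty A›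
    obtain ⟨g, hg, hmax⟩ := exists_hasUniqueMaximalTree (fun v => ⟨δ v a₀, a₀, rfl⟩) hconn hbunch
      hbranch
    choose α hα using hg
    refine ⟨fun v => Equiv.swap a₀ (α v), ?_⟩
    refine exists_stable_of_hasUniqueMaximalTree (a := a₀) (fun v w => ?_) (by simpa [hα])
    refine (hconn v w).lift id ?_
    rintro x y ⟨a, rfl⟩
    exact ⟨Equiv.swap a₀ (α x) a, by simp⟩
  · right
    push Not at hbranch
    exact fun v a b => hbranch v _ _ ⟨a, rfl⟩ ⟨b, rfl⟩

end Finite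

theorem exists_potential_of_cycle [Nonempty V] {f : V → V}
    (hconn : ∀ v w, ∃ n, f^[n] v = w) :
    ∃ n, 0 < n ∧ Nat.card V ≤ n ∧ ∃ φ : V → ZMod n, ∀ v, φ (f v) = φ v + 1 := by
  obtain ⟨v₀⟩ := ‹Nonempty V›
  choose i hi using hconn v₀
  have hper : v₀ ∈ periodicPts f := by
    obtain ⟨n, hn⟩ := hconn (f v₀) v₀
    refine ⟨n + 1, by omega, ?_⟩
    change f^[n + 1] v₀ = v₀
    rwa [iterate_succ_apply]
  have hpos := minimalPeriod_pos_of_mem_periodicPts hper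
  refine ⟨minimalPeriod f v₀, hpos, ?_, fun v => (i v : ZMod _), fun v => ?_⟩
  · have hs : Surjective fun k : Fin (minimalPeriod f v₀) => f^[(k : ℕ)] v₀ := fun v =>
      ⟨⟨i v % _, Nat.mod_lt _ hpos⟩, by
        change f^[i v % minimalPeriod f v₀] v₀ = v
        rw [iterate_mod_minimalPeriod_eq, hi]⟩
    simpa using Nat.card_le_card_of_surjective _ hs
  · have h1 : f^[i (f v)] v₀ = f^[i v + 1] v₀ := by
      rw [hi, iterate_succ_apply', hi]
    rw [← iterate_mod_minimalPeriod_eq, ← iterate_mod_minimalPeriod_eq (n := i v + 1),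
      iterate_eq_iterate_iff_of_lt_minimalPeriod (Nat.mod_lt _ hpos) (Nat.mod_lt _ hpos)] at h1
    have := (ZMod.natCast_eq_natCast_iff _ _ _).2 h1
    simpa using this

end Automaton

/-! ### Induction on the quotient by stability -/

section Recoloring

open Function

universe u

variable {A : Type*} {V : Type u} {δ : V → A → V}

/-- The transition function induced on the classes of stable states. -/
def quotientStep (δ : V → A → V) (x : Quotient (stableSetoid δ)) (a : A) :
    Quotient (stableSetoid δ) :=
  Quotient.map (sa := stableSetoid δ) (sb := stableSetoid δ) (fun v => δ v a)
    (fun _ _ h => h.step a) x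

/-- A recoloring of the quotient by stability lifts, and its words bound the ranks above. -/
theorem exists_word_of_quotient [Finite V]
    (π : Quotient (stableSetoid δ) → Equiv.Perm A) (w : List A) :
    ∃ u : List A, (imageOf (fun v a => δ v (π (Quotient.mk _ v) a)) u).ncard ≤
      (imageOf (fun x a => quotientStep δ x (π x a)) w).ncard := by
  set δ' : V → A → V := fun v a => δ v (π (Quotient.mk _ v) a) with hδ'
  set δq : Quotient (stableSetoid δ) → A → Quotient (stableSetoid δ) :=
    fun x a => quotientStep δ x (π x a) with hδq
  have hmk : ∀ (t : List A) v,
      Quotient.mk (stableSetoid δ) (t.foldl δ' v) = t.foldl δq (Quotient.mk _ v) := by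
    intro t
    induction t with
    | nil => exact fun v => rfl
    | cons a t ih => exact fun v => ih _
  have hmerge : ∀ (t : List A) p q, Stable δ p q → t.foldl δ p = t.foldl δ q →
      ∃ t' : List A, t'.foldl δ' p = t'.foldl δ' q := by
    intro t
    induction t with
    | nil => exact fun p q _ h => ⟨[], h⟩
    | cons a t ih =>
      intro p q hpq h
      obtain ⟨t', ht'⟩ := ih (δ p a) (δ q a) (hpq.step a) h
      -- Stable states share their permutation, so a merging word for `δ` translates letter by
      -- letter into one for `δ'`.
      refine ⟨(π (Quotient.mk _ p)).symm a :: t', ?_⟩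
      have hclass : Quotient.mk (stableSetoid δ) p = Quotient.mk (stableSetoid δ) q :=
        Quotient.sound hpq
      have h1 : δ' p ((π (Quotient.mk _ p)).symm a) = δ p a := by simp [hδ']
      have h2 : δ' q ((π (Quotient.mk _ p)).symm a) = δ q a := by rw [hclass]; simp [hδ']
      rw [List.foldl_cons, List.foldl_cons, h1, h2, ht']
  obtain ⟨m, hm⟩ := exists_isMinimalWord δ'
  refine ⟨m ++ w, ?_⟩
  have hm' := hm.append w
  have hinj : Set.InjOn (Quotient.mk (stableSetoid δ)) (imageOf δ' (m ++ w)) := by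
    intro p hp q hq hpq
    have hst : Stable δ p q := Quotient.exact hpq
    obtain ⟨t, ht⟩ := hst []
    obtain ⟨t', ht'⟩ := hmerge t p q hst ht
    exact hm'.injOn t' hp hq ht'
  rw [← hinj.ncard_image]
  refine Set.ncard_le_ncard ?_ (Set.toFinite _)
  rintro _ ⟨_, ⟨v, rfl⟩, rfl⟩
  refine ⟨Quotient.mk _ (m.foldl δ' v), ?_⟩
  simp only [List.foldl_append]
  exact (hmk w _).symm

/-- Every strongly connected automaton has a recoloring with a word of rank at most `n` for some
`n` such that the states carry a potential modulo `n` that increases by one along every edge. -/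
theorem exists_recoloring_rank_le [Nonempty A] [Finite V] [Nonempty V] (δ : V → A → V)
    (hconn : ∀ v w, Relation.ReflTransGen (fun x y => ∃ a, δ x a = y) v w) :
    ∃ (π : V → Equiv.Perm A) (n : ℕ), 0 < n ∧
      (∃ φ : V → ZMod n, ∀ v a, φ (δ v a) = φ v + 1) ∧
      ∃ w, (imageOf (fun v a => δ v (π v a)) w).ncard ≤ n := by
  induction hN : Nat.card V using Nat.strong_induction_on generalizing V with
  | _ N ih =>
  subst hN
  rcases exists_recoloring_stable hconn with ⟨π, p, q, hpq, hst⟩ | hconst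
  · set δ₁ : V → A → V := fun v a => δ v (π v a) with hδ₁
    have hcard : Nat.card (Quotient (stableSetoid δ₁)) < Nat.card V := by
      refine lt_of_le_of_ne (Nat.card_le_card_of_surjective _ Quotient.mk_surjective)
        fun he => hpq ?_
      have := (Quotient.mk_surjective (s := stableSetoid δ₁)).bijective_of_nat_card_le he.ge
      exact this.1 (Quotient.sound hst)
    have hconn' : ∀ x y, Relation.ReflTransGen
        (fun x y => ∃ a, quotientStep δ₁ x a = y) x y := by
      intro x y
      induction x using Quotient.inductionOn with | _ v
      induction y using Quotient.inductionOn with | _ w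
      refine (hconn v w).lift _ ?_
      rintro x _ ⟨a, rfl⟩
      refine ⟨(π x).symm a, ?_⟩
      change Quotient.mk _ (δ x (π x ((π x).symm a))) = _
      rw [Equiv.apply_symm_apply]
    have : Nonempty (Quotient (stableSetoid δ₁)) := ⟨Quotient.mk _ p⟩
    obtain ⟨π', n, hn, ⟨φ, hφ⟩, w, hw⟩ := ih _ hcard (quotientStep δ₁) hconn' rfl
    obtain ⟨u, hu⟩ := exists_word_of_quotient π' w
    refine ⟨fun v => π v * π' (Quotient.mk _ v), n, hn, ⟨fun v => φ (Quotient.mk _ v), ?_⟩, u,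
      hu.trans hw⟩
    intro v a
    -- This letter makes the recolored step follow the original edge `a`.
    rw [← hφ _ ((π v).symm a)]
    change _ = φ (Quotient.mk _ (δ v (π v ((π v).symm a))))
    rw [Equiv.apply_symm_apply]
  · obtain ⟨a⟩ := ‹Nonempty A›
    have hit : ∀ v w, ∃ n, (fun v => δ v a)^[n] v = w := by
      intro v w
      induction hconn v w with
      | refl => exact ⟨0, rfl⟩
      | tail _ h ih =>
        obtain ⟨n, rfl⟩ := ih
        obtain ⟨b, rfl⟩ := h
        exact ⟨n + 1, by rw [iterate_succ_apply']; exact hconst _ _ _⟩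
    obtain ⟨n, hn, hcard, φ, hφ⟩ := exists_potential_of_cycle hit
    refine ⟨fun _ => 1, n, hn, ⟨φ, fun v b => ?_⟩, [], ?_⟩
    · rw [hconst v b a, hφ]
    · refine le_trans ?_ hcard
      rw [← Set.ncard_univ]
      exact Set.ncard_le_ncard (Set.subset_univ _) (Set.toFinite _)

end Recoloring

/-! ### Cycle lengths and potentials -/

section Periodicity

variable {V : Type*} [Quiver V]

open Quiver

theorem exists_eq_comp_of_mem_cons_toList {a b c : V} (p : Path a b) (hc : c ∈ b :: p.toList) :
    ∃ (q : Path a c) (r : Path c b), p = q.comp r := by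
  induction p with
  | nil =>
    obtain rfl : c = a := by simpa using hc
    exact ⟨.nil, .nil, rfl⟩
  | @cons b' b p e ih =>
    rcases List.mem_cons.1 hc with rfl | h
    · exact ⟨p.cons e, .nil, rfl⟩
    · obtain ⟨q, r, rfl⟩ := ih h
      exact ⟨q, r.cons e, rfl⟩

/-- Removing cycles turns every path into a path without repeated vertices. -/
theorem exists_simple_path {k : ℕ} (hk : ∀ n ∈ cycleLengths V, k ∣ n) {a b : V} (p : Path a b) :
    ∃ p' : Path a b, (b :: p'.toList).Nodup ∧ p.length ≡ p'.length [MOD k] := by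
  induction p with
  | nil => exact ⟨.nil, by simp, rfl⟩
  | @cons b c p e ih =>
    obtain ⟨p', hp', hlen⟩ := ih
    by_cases hc : c ∈ b :: p'.toList
    -- The path returns to `c`: cutting there splits off the cycle `r.cons e`, whose length is a
    -- multiple of `k`.
    · obtain ⟨q, r, rfl⟩ := exists_eq_comp_of_mem_cons_toList p' hc
      rw [Path.toList_comp] at hp'
      have hcyc : k ∣ r.length + 1 := by
        refine hk _ ⟨c, r.cons e, ⟨Nat.succ_pos _, ?_⟩, rfl⟩
        exact hp'.sublist ((List.sublist_append_left _ _).cons_cons b)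
      refine ⟨q, ?_, ?_⟩
      · cases r with
        | nil => simpa using hp'
        | cons r e' =>
          refine List.Nodup.sublist ?_ (List.nodup_cons.1 hp').2
          have hmem : ∀ {x : V} (s : Path c x), [c].Sublist (x :: s.toList) := by
            intro x s
            induction s with
            | nil => simp
            | cons s _ ih => exact ih.cons _
          exact (hmem r).append (List.Sublist.refl _)
      · rw [Path.length_comp] at hlen
        rw [Path.length_cons]
        calc p.length + 1 ≡ q.length + r.length + 1 [MOD k] := hlen.add_right 1
          _ = q.length + (r.length + 1) := add_assoc _ _ _
          _ ≡ q.length + 0 [MOD k] := ((Nat.modEq_zero_iff_dvd).2 hcyc).add_left _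
    · exact ⟨p'.cons e, List.nodup_cons.2 ⟨hc, hp'⟩, hlen.add_right 1⟩

theorem dvd_length_of_closed {k : ℕ} (hk : ∀ n ∈ cycleLengths V, k ∣ n) {a : V} (p : Path a a) :
    k ∣ p.length := by
  obtain ⟨p', hp', hlen⟩ := exists_simple_path hk p
  have hnil : ∀ {b : V} (p : Path a b), p.length ≠ 0 → a ∈ p.toList := by
    intro b p
    induction p with
    | nil => simp
    | cons p e ih =>
      intro _
      by_cases h : p.length = 0
      · obtain rfl := p.eq_of_length_zero h
        exact List.mem_cons_self
      · exact List.mem_cons_of_mem _ (ih h)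
  have h0 : p'.length = 0 := by
    by_contra h
    exact (List.nodup_cons.1 hp').1 (hnil p' h)
  rw [h0] at hlen
  exact (Nat.modEq_zero_iff_dvd).1 hlen

/-- The length modulo `k` of a path from a base vertex depends only on its end: closing two such
paths by the same return path gives lengths divisible by `k`. -/
theorem exists_potential (hconn : IsStronglyConnected V) [Nonempty V] {k : ℕ}
    (hk : ∀ n ∈ cycleLengths V, k ∣ n) :
    ∃ φ : V → ZMod k, ∀ ⦃v w : V⦄, (v ⟶ w) → φ w = φ v + 1 := by
  obtain ⟨v₀⟩ := ‹Nonempty V›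
  have hind : ∀ {v : V} (p q : Path v₀ v), (p.length : ZMod k) = q.length := by
    intro v p q
    obtain ⟨r⟩ := hconn v v₀
    have hp := (ZMod.natCast_eq_zero_iff _ _).2 (dvd_length_of_closed hk (p.comp r))
    have hq := (ZMod.natCast_eq_zero_iff _ _).2 (dvd_length_of_closed hk (q.comp r))
    rw [Path.length_comp, Nat.cast_add] at hp hq
    exact add_right_cancel (hp.trans hq.symm)
  refine ⟨fun v => ((hconn v₀ v).some.length : ZMod k), fun v w e => ?_⟩
  exact (hind _ ((hconn v₀ v).some.cons e)).trans
    (by rw [Path.length_cons, Nat.cast_add, Nat.cast_one])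

theorem dvd_of_potential {n : ℕ} {φ : V → ZMod n}
    (hφ : ∀ ⦃v w : V⦄, (v ⟶ w) → φ w = φ v + 1) : ∀ l ∈ cycleLengths V, n ∣ l := by
  rintro _ ⟨a, p, -, rfl⟩
  have key : ∀ {b : V} (p : Path a b), φ b = φ a + p.length := by
    intro b p
    induction p with
    | nil => simp
    | cons p e ih => rw [hφ e, ih, Path.length_cons, Nat.cast_add, Nat.cast_one, add_assoc]
  exact (ZMod.natCast_eq_zero_iff _ _).1 (by simpa using key p)

theorem IsPeriodic.eq {k n : ℕ} (hk : IsPeriodic V k) (hn : IsPeriodic V n) : k = n :=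
  Nat.dvd_antisymm (hn.2 k hk.1) (hk.2 n hn.1)

end Periodicity

/-! ### Ranks of colorings and the conclusion -/

namespace Coloring

variable {V : Type*} [Quiver V] {d : ℕ}

theorem IsSynchronizing.eq {c c' : Coloring V d} {k n : ℕ} (hk : c.IsSynchronizing k)
    (hn : c'.IsSynchronizing n) : k = n :=
  le_antisymm (hk.2 _ _ hn.1) (hn.2 _ _ hk.1)

theorem step_eq_of_edge (c : Coloring V d) {v w : V} (e : v ⟶ w) : ∃ a, c.step v a = w :=
  ⟨c v ⟨w, e⟩, by simp [step]⟩

/-- Every word has rank at least `n` if there is a potential modulo `n`. -/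
theorem le_ncard_image [Finite V] [Nonempty V] (hd : 0 < d) (c : Coloring V d) {n : ℕ}
    (hn : 0 < n) {φ : V → ZMod n} (hφ : ∀ ⦃v w : V⦄, (v ⟶ w) → φ w = φ v + 1)
    (t : List (Fin d)) : n ≤ (c.image t).ncard := by
  have hrun : ∀ (t : List (Fin d)) v, φ (c.run v t) = φ v + t.length := by
    intro t
    induction t with
    | nil => simp [run]
    | cons a t ih =>
      intro v
      have hstep : φ (c.step v a) = φ v + 1 := hφ ((c v).symm a).2
      rw [show c.run v (a :: t) = c.run (c.step v a) t from rfl, ih, hstep, List.length_cons, Nat.cast_add, Nat.cast_one]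
      ring
  have : NeZero n := ⟨hn.ne'⟩
  obtain ⟨v₀⟩ := ‹Nonempty V›
  have himage : φ '' c.image t = Set.univ := by
    refine Set.eq_univ_of_forall fun z => ?_
    -- The length of `u` is chosen so that reading `u` and then `t` from `v₀` ends at potential `z`.
    let u : List (Fin d) := List.replicate (z - t.length - φ v₀).val ⟨0, hd⟩
    refine ⟨_, ⟨c.run v₀ u, rfl⟩, ?_⟩
    rw [hrun, hrun, List.length_replicate, ZMod.natCast_zmod_val]
    ring
  calc n = (Set.univ : Set (ZMod n)).ncard := by rw [Set.ncard_univ, Nat.card_zmod]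
    _ = (φ '' c.image t).ncard := by rw [himage]
    _ ≤ _ := Set.ncard_image_le

theorem exists_hasSynchronizingWord [Finite V] (hd : 0 < d) (c : Coloring V d) :
    ∃ m, c.HasSynchronizingWord m := by
  obtain ⟨w, hw⟩ := exists_isMinimalWord c.step
  -- The extra letter makes the word nonempty and keeps its rank minimal.
  exact ⟨_, w ++ [⟨0, hd⟩], by simp, rfl, hw.append _⟩

/-- The coloring obtained by permuting the colors at each vertex. -/
def recolor (c : Coloring V d) (π : V → Equiv.Perm (Fin d)) : Coloring V d :=
  fun v => (c v).trans (π v).symm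

end Coloring

theorem exists_isPeriodic_and_isSynchronizing {V : Type*} [Quiver V] [Finite V] {d : ℕ}
    (hd : 0 < d) (hout : HasUniformOutdegree V d) (hconn : Quiver.IsStronglyConnected V) :
    ∃ n, IsPeriodic V n ∧ ∃ c : Coloring V d, c.IsSynchronizing n := by
  let c : Coloring V d := fun v =>
    have := (hout v).1
    Finite.equivFinOfCardEq (hout v).2
  rcases isEmpty_or_nonempty V with hV | hV
  -- The empty graph has no cycles, so the gcd is `0`, which is also the size of every image.
  · refine ⟨0, ⟨?_, fun m _ => dvd_zero m⟩, c, ?_, fun _ m _ => Nat.zero_le m⟩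
    · rintro _ ⟨a, -⟩
      exact hV.elim a
    · exact ⟨[⟨0, hd⟩], by simp, by simp [Coloring.image, Set.range_eq_empty], fun _ => Nat.zero_le _⟩
  have hreach : ∀ v w, Relation.ReflTransGen (fun x y => ∃ a, c.step x a = y) v w := by
    intro v w
    obtain ⟨p⟩ := hconn v w
    induction p with
    | nil => exact .refl
    | cons p e ih => exact ih.tail (c.step_eq_of_edge e)
  have : Nonempty (Fin d) := ⟨⟨0, hd⟩⟩
  obtain ⟨π, n, hn, ⟨φ, hφ⟩, w, hw⟩ := exists_recoloring_rank_le c.step hreach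
  have hφ' : ∀ ⦃v w : V⦄, (v ⟶ w) → φ w = φ v + 1 := by
    intro v w e
    obtain ⟨a, rfl⟩ := c.step_eq_of_edge e
    exact hφ v a
  -- By definition `recolor` steps from `v` by color `a` as `c.step v (π v a)`.
  have hrank : ((c.recolor π).image w).ncard ≤ n := hw
  have hdvd := dvd_of_potential hφ'
  have hmin : ∀ (c' : Coloring V d) (m : ℕ), c'.HasSynchronizingWord m → n ≤ m := by
    rintro c' m ⟨s, -, rfl, -⟩
    exact c'.le_ncard_image hd hn hφ' s
  refine ⟨n, ⟨hdvd, fun m hm => ?_⟩, c.recolor π, ?_, hmin⟩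
  · have hlcm : ∀ l ∈ cycleLengths V, Nat.lcm m n ∣ l := fun l hl =>
      Nat.lcm_dvd (hm l hl) (hdvd l hl)
    obtain ⟨ψ, hψ⟩ := exists_potential hconn hlcm
    -- A closed path of positive length excludes `m = 0`.
    have hpos : 0 < Nat.lcm m n := by
      obtain ⟨v⟩ := hV
      obtain ⟨p⟩ := hconn (c.step v ⟨0, hd⟩) v
      have h := dvd_length_of_closed hlcm (p.cons ((c v).symm ⟨0, hd⟩).2)
      exact Nat.pos_of_dvd_of_pos h (Nat.succ_pos _)
    have hle := ((c.recolor π).le_ncard_image hd hpos hψ w).trans hrank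
    rw [← Nat.le_antisymm hle (Nat.le_of_dvd hpos (Nat.dvd_lcm_right m n))]
    exact Nat.dvd_lcm_left m n
  · obtain ⟨m, hm⟩ := (c.recolor π).exists_hasSynchronizingWord hd
    obtain rfl : m = n := by
      refine le_antisymm ?_ (hmin _ _ hm)
      obtain ⟨s, -, -, hs⟩ := hm
      exact (hs w).trans hrank
    exact hm

end RoadColoring

theorem theorem2 {V : Type*} [Quiver V] [Finite V] (d : ℕ) (hd : 0 < d)
    (hout : RoadColoring.HasUniformOutdegree V d)
    (hconn : Quiver.IsStronglyConnected V) (k : ℕ) :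
    (RoadColoring.IsPeriodic V k ↔
        ∃ c : RoadColoring.Coloring V d, c.IsSynchronizing k) ∧
      (RoadColoring.IsPeriodic V k →
        ∀ c : RoadColoring.Coloring V d,
          (∃ m : ℕ, c.HasSynchronizingWord m) ∧
            ∀ m : ℕ, c.HasSynchronizingWord m → k ≤ m) := by
  obtain ⟨n, hn, c, hc⟩ := RoadColoring.exists_isPeriodic_and_isSynchronizing hd hout hconn
  refine ⟨⟨fun hk => ⟨c, hk.eq hn ▸ hc⟩, fun ⟨c', hc'⟩ => hc'.eq hc ▸ hn⟩, fun hk c' => ?_⟩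
  exact ⟨c'.exists_hasSynchronizingWord hd, hk.eq hn ▸ hc.2 c'⟩
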